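/- Let $n$ be a natural number, let $\mathbb F_q$ be a finite field of characteristic different from $2$, and fix a nontrivial character $t\mapsto\varepsilon^t$ of the additive group of $\mathbb F_q$ with values in $\mathbb C^*$. Let $\mathfrak b$ be the algebra of upper triangular $n\times n$ matrices over $\mathbb F_q$, let $\mathfrak n\subset\mathfrak b$ be the strictly upper triangular ones, and let $\mathfrak n^*$ be the dual space, with the left and right actions $(t\lambda)(x)=\lambda(xt)$, $(\lambda t)(x)=\lambda(tx)$ of $t\in\mathfrak b$. Let $\mathfrak g^a=\mathfrak b\oplus\mathfrak n^*$ be the associative algebra with the multiplication $(t_1+\lambda_1)(t_2+\lambda_2)=t_1t_2+t_1\lambda_2+\lambda_1t_2$, let $\mathfrak U=\mathfrak n\oplus\mathfrak n^*$, and let $U^a=1+\mathfrak U$, a subgroup of the group of invertible elements of $\mathfrak g^a$. Denote by $E_{ij}$ ($i<j$) the matrix units in $\mathfrak n$ and by $F_{ij}$ ($i>j$) the basis of $\mathfrak n^*$ with $F_{ij}(E_{km})=\delta_{jk}\delta_{im}$, and define a bilinear form on $\mathfrak U$ by $(x_1+\lambda_1,x_2+\lambda_2)=\lambda_2(x_1)+\lambda_1(x_2)$.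 A root is a pair $(i,j)$ with $1\le i,j\le n$, $i\ne j$. A rook placement $D$ is a set of roots with at most one root in any row and at most one root in any column. Consider the pairs $(D,\phi)$, where $D$ is a rook placement and $\phi:D\to\mathbb F_q^*$ is a map. Put $$X_{D,\phi}=\sum_{\gamma\in D,\ \gamma=(i,j),\ i<j}\phi(\gamma)E_{ij}+\sum_{\gamma\in D,\ \gamma=(i,j),\ i>j}\phi(\gamma)F_{ij},\qquad K_{D,\phi}=1+U^aX_{D,\phi}U^a .$$ Let $D^t=\{(j,i):(i,j)\in D\}$, $\phi^t(j,i)=\phi(i,j)$, and $\Lambda_{D,\phi}(Y)=(X_{D^t,\phi^t},Y)$ for $Y\in\mathfrak U$. For a root $\gamma=(i,j)$ let $S(\gamma)=\{(i,k): i<k<j\}$ if $i<j$, and $S(\gamma)=\{(i,k): k<j\}\cup\{(i,k): k>i\}$ if $i>j$. Let $\mathfrak U_D\subset\mathfrak U$ be the span of those basis elements $E_\beta$, $F_\beta$ for which $\beta\notin\bigcup_{\gamma\in D}S(\gamma)$. Then $U_D=1+\mathfrak U_D$ is a subgroup of $U^a$, and $\xi_{D,\phi}(1+X)=\varepsilon^{\Lambda_{D,\phi}(X)}$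 is a linear character of it. Let $\chi_{D,\phi}=\mathrm{Ind}_{U_D}^{U^a}\xi_{D,\phi}$. Then the systems $\{\chi_{D,\phi}\}$ and $\{K_{D,\phi}\}$, both indexed by all pairs $(D,\phi)$, form a supercharacter theory of $U^a$: the $\chi_{D,\phi}$ are characters of nonzero complex representations of $U^a$; the sets $K_{D,\phi}$ are nonempty, pairwise disjoint for distinct pairs $(D,\phi)$, and cover $U^a$; the characters $\chi_{D,\phi}$ and $\chi_{D',\phi'}$ are orthogonal for $(D,\phi)\ne(D',\phi')$; each $\chi_{D,\phi}$ is constant on each $K_{D',\phi'}$; and $\{1\}$ is one of the sets $K_{D,\phi}$. -/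

import Mathlib

/-!
The Borel contraction of `gl(n, K)`, its unipotent group `U^a`, rook placements, and the
characters and subsets of `U^a` attached to them.  Roots are pairs `(i, j)` with `i ≠ j` in
`Fin n`, i.e. row and column numbers run through `0, …, n - 1`.
-/

section SupercharacterTheory

/-- `χ` is the character of a nonzero finite dimensional complex representation of `G`. -/
def IsComplexCharacter {G : Type*} [Group G] (χ : G → ℂ) : Prop :=
  ∃ d : ℕ, 0 < d ∧ ∃ ρ : Representation ℂ G (Fin d → ℂ), ρ.character = χ

/-- The Hermitian inner product of complex functions on a finite group. -/
noncomputable def characterInner {G : Type*} [Fintype G] (χ ψ : G → ℂ) : ℂ :=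
  (Fintype.card G : ℂ)⁻¹ * ∑ g : G, χ g * (starRingEnd ℂ) (ψ g)

/-- A supercharacter theory of a finite group `G`: a system of complex characters and a partition
of `G`, with the same number of members (they share the index type `ι`), such that the characters
are pairwise orthogonal, each character is constant on each part, and `{1}` is a part.
Distinct indices give distinct parts (nonempty and disjoint) and distinct characters
(nonzero and orthogonal). -/
structure IsSupercharacterTheory {G : Type*} [Group G] [Fintype G] {ι : Type*}
    (χ : ι → G → ℂ) (P : ι → Set G) : Prop where
  isCharacter : ∀ i, IsComplexCharacter (χ i)
  nonempty : ∀ i, (P i).Nonempty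
  disjoint : Pairwise fun i j => Disjoint (P i) (P j)
  cover : ⋃ i, P i = Set.univ
  orthogonal : Pairwise fun i j => characterInner (χ i) (χ j) = 0
  constant : ∀ i j, ∀ g ∈ P j, ∀ h ∈ P j, χ i g = χ i h
  one : ∃ j, P j = {1}

end SupercharacterTheory

section Contraction

/-- The component of a matrix in the algebra `b` of upper triangular matrices. -/
def upperPart {n : ℕ} {K : Type*} [Field K] :
    Matrix (Fin n) (Fin n) K →ₗ[K] Matrix (Fin n) (Fin n) K where
  toFun X := Matrix.of fun i j => if i ≤ j then X i j else 0
  map_add' X Y := by ext i j; by_cases h : i ≤ j <;> simp [h]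
  map_smul' c X := by ext i j; by_cases h : i ≤ j <;> simp [h]

/-- The component of a matrix in the space `n_-` of strictly lower triangular matrices. -/
def lowerPart {n : ℕ} {K : Type*} [Field K] :
    Matrix (Fin n) (Fin n) K →ₗ[K] Matrix (Fin n) (Fin n) K where
  toFun X := Matrix.of fun i j => if j < i then X i j else 0
  map_add' X Y := by ext i j; by_cases h : j < i <;> simp [h]
  map_smul' c X := by ext i j; by_cases h : j < i <;> simp [h]

theorem upperPart_apply {n : ℕ} {K : Type*} [Field K] (X : Matrix (Fin n) (Fin n) K)
    (i j : Fin n) : upperPart X i j = if i ≤ j then X i j else 0 := rfl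

theorem lowerPart_apply {n : ℕ} {K : Type*} [Field K] (X : Matrix (Fin n) (Fin n) K)
    (i j : Fin n) : lowerPart X i j = if j < i then X i j else 0 := rfl

theorem upperPart_add_lowerPart {n : ℕ} {K : Type*} [Field K] (X : Matrix (Fin n) (Fin n) K) :
    upperPart X + lowerPart X = X := by
  ext i j
  by_cases h : i ≤ j
  · simp [upperPart_apply, lowerPart_apply, h, not_lt.mpr h]
  · simp [upperPart_apply, lowerPart_apply, h, not_le.mp h]

/-- The Borel contraction of `gl(n, K)`: the space `b ⊕ n^*`, where `n^*` is identified with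
`n_-` by `λ(x) = tr(λ x)`, so that the underlying space is that of all `n × n` matrices.
The multiplication below is not the matrix multiplication. -/
def BorelContraction (n : ℕ) (K : Type*) : Type _ := Matrix (Fin n) (Fin n) K

namespace BorelContraction

variable {n : ℕ} {K : Type*} [Field K]

instance : AddCommGroup (BorelContraction n K) :=
  inferInstanceAs (AddCommGroup (Matrix (Fin n) (Fin n) K))

instance : Module K (BorelContraction n K) :=
  inferInstanceAs (Module K (Matrix (Fin n) (Fin n) K))

instance [Finite K] : Finite (BorelContraction n K) :=
  inferInstanceAs (Finite (Matrix (Fin n) (Fin n) K))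

/-- The underlying matrix; its entry at `(i, j)` is the coefficient of `E_ij` if `i ≤ j`, and of
`F_ij` if `i > j`. -/
def toMatrix : BorelContraction n K ≃ₗ[K] Matrix (Fin n) (Fin n) K :=
  LinearEquiv.refl K (Matrix (Fin n) (Fin n) K)

/-- `(t₁ + λ₁)(t₂ + λ₂) = t₁ t₂ + t₁ λ₂ + λ₁ t₂` for `tᵢ ∈ b` and `λᵢ ∈ n^*`.  Here
`(t λ)(x) = λ(x t)` and `(λ t)(x) = λ(t x)` for `x` strictly upper triangular; under
`n^* = n_-` these are the strictly lower triangular parts of the matrix products. -/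
instance : Mul (BorelContraction n K) where
  mul X Y := toMatrix.symm
    (upperPart (toMatrix X) * upperPart (toMatrix Y) +
      lowerPart (upperPart (toMatrix X) * lowerPart (toMatrix Y) +
        lowerPart (toMatrix X) * upperPart (toMatrix Y)))

instance : One (BorelContraction n K) where
  one := toMatrix.symm 1

theorem toMatrix_mul (X Y : BorelContraction n K) : toMatrix (X * Y) =
    upperPart (toMatrix X) * upperPart (toMatrix Y) +
      lowerPart (upperPart (toMatrix X) * lowerPart (toMatrix Y) +
        lowerPart (toMatrix X) * upperPart (toMatrix Y)) := rfl

theorem toMatrix_one : toMatrix (1 : BorelContraction n K) = 1 := rfl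

/-- Multiplication in coordinates. -/
theorem toMatrix_mul_apply (X Y : BorelContraction n K) (i j : Fin n) :
    toMatrix (X * Y) i j = ∑ k : Fin n,
      if (i ≤ k ∧ k ≤ j) ∨ (j < i ∧ (i ≤ k ∨ k ≤ j)) then
        toMatrix X i k * toMatrix Y k j else 0 := by
  rw [toMatrix_mul, Matrix.add_apply, lowerPart_apply, Matrix.add_apply, Matrix.mul_apply,
    Matrix.mul_apply, Matrix.mul_apply]
  simp only [upperPart_apply, lowerPart_apply]
  by_cases h : j < i
  · rw [if_pos h, ← Finset.sum_add_distrib, ← Finset.sum_add_distrib]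
    refine Finset.sum_congr rfl fun k _ => ?_
    split_ifs <;> first | (exfalso; omega) | simp
  · rw [if_neg h, add_zero]
    refine Finset.sum_congr rfl fun k _ => ?_
    split_ifs <;> first | (exfalso; omega) | simp

instance : Ring (BorelContraction n K) :=
  { (inferInstance : AddCommGroup (BorelContraction n K)),
    (inferInstance : Mul (BorelContraction n K)),
    (inferInstance : One (BorelContraction n K)) with
    left_distrib := fun X Y Z => by
      apply toMatrix.injective
      simp only [map_add, toMatrix_mul, mul_add]
      abel
    right_distrib := fun X Y Z => by
      apply toMatrix.injective
      simp only [map_add, toMatrix_mul, add_mul]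
      abel
    zero_mul := fun X => by
      apply toMatrix.injective
      simp only [map_zero, toMatrix_mul, zero_mul, add_zero]
    mul_zero := fun X => by
      apply toMatrix.injective
      simp only [map_zero, toMatrix_mul, mul_zero, add_zero]
    one_mul := fun X => by
      apply toMatrix.injective
      ext i j
      rw [toMatrix_mul_apply, Finset.sum_eq_single i]
      · rw [if_pos (by omega), toMatrix_one, Matrix.one_apply_eq, one_mul]
      · intro k _ hk
        simp [toMatrix_one, Matrix.one_apply_ne hk.symm]
      · simp
    mul_one := fun X => by
      apply toMatrix.injective
      ext i j
      rw [toMatrix_mul_apply, Finset.sum_eq_single j]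
      · rw [if_pos (by omega), toMatrix_one, Matrix.one_apply_eq, mul_one]
      · intro k _ hk
        simp [toMatrix_one, Matrix.one_apply_ne hk]
      · simp
    mul_assoc := fun X Y Z => by
      apply toMatrix.injective
      ext i j
      simp only [toMatrix_mul_apply, Finset.sum_mul, Finset.mul_sum, ← Finset.sum_filter]
      simp only [Finset.sum_filter]
      have hl : ∀ (p : Prop) [Decidable p] (f : Fin n → K),
          (if p then ∑ b, f b else 0) = ∑ b, if p then f b else 0 := by
        intro p _ f
        split_ifs <;> simp
      simp only [hl]
      rw [Finset.sum_comm]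
      refine Finset.sum_congr rfl fun b _ => Finset.sum_congr rfl fun a _ => ?_
      simp only [← ite_and, mul_assoc]
      exact if_congr (by omega) rfl rfl }

/-- The radical `𝔘 = n + n^*`: the elements with zero diagonal. -/
def radical (n : ℕ) (K : Type*) [Field K] : Submodule K (BorelContraction n K) where
  carrier := {X | ∀ i, toMatrix X i i = 0}
  add_mem' := fun {X Y} hX hY i => by simp [hX i, hY i]
  zero_mem' := fun i => by simp
  smul_mem' := fun c X hX i => by simp [hX i]

theorem radical_mul_mem (X Y : BorelContraction n K) (hX : X ∈ radical n K) :
    X * Y ∈ radical n K := by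
  intro i
  rw [toMatrix_mul_apply]
  refine Finset.sum_eq_zero fun k _ => ?_
  split_ifs with h
  · obtain rfl : k = i := by omega
    rw [hX k, zero_mul]
  · rfl

/-- The group `U^a = 1 + 𝔘`, as a subgroup of the group of invertible elements of the Borel
contraction. -/
def unipotentGroup (n : ℕ) (K : Type*) [Field K] : Subgroup (BorelContraction n K)ˣ where
  carrier := {u | (u : BorelContraction n K) - 1 ∈ radical n K}
  one_mem' := by simp
  mul_mem' := fun {u v} hu hv => by
    have h : ((u * v : (BorelContraction n K)ˣ) : BorelContraction n K) - 1 =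
        ((u : BorelContraction n K) - 1) * v + ((v : BorelContraction n K) - 1) := by
      rw [Units.val_mul]; noncomm_ring
    simp only [Set.mem_ofPred_eq, h]
    exact add_mem (radical_mul_mem _ _ hu) hv
  inv_mem' := fun {u} hu => by
    have h : ((u⁻¹ : (BorelContraction n K)ˣ) : BorelContraction n K) - 1 =
        -(((u : BorelContraction n K) - 1) * (u⁻¹ : (BorelContraction n K)ˣ)) := by
      rw [sub_mul, Units.mul_inv]; noncomm_ring
    simp only [Set.mem_ofPred_eq, h]
    exact neg_mem (radical_mul_mem _ _ hu)

/-- The element `X` of `𝔘` with `u = 1 + X`, for `u ∈ U^a`. -/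
def nilPart (u : unipotentGroup n K) : BorelContraction n K :=
  ((u : (BorelContraction n K)ˣ) : BorelContraction n K) - 1

theorem nilPart_mem (u : unipotentGroup n K) : nilPart u ∈ radical n K := u.2

theorem nilPart_one : nilPart (1 : unipotentGroup n K) = 0 := by simp [nilPart]

theorem nilPart_mul (u v : unipotentGroup n K) :
    nilPart (u * v) = nilPart u + nilPart v + nilPart u * nilPart v := by
  simp only [nilPart, Subgroup.coe_mul, Units.val_mul]
  noncomm_ring

noncomputable instance [Finite K] : Fintype (unipotentGroup n K) := Fintype.ofFinite _

/-- The symmetric bilinear form `(x₁ + λ₁, x₂ + λ₂) = λ₂(x₁) + λ₁(x₂)` (on `𝔘`). -/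
def form (X Y : BorelContraction n K) : K :=
  (lowerPart (toMatrix Y) * upperPart (toMatrix X)).trace +
    (lowerPart (toMatrix X) * upperPart (toMatrix Y)).trace

theorem form_eq_sum (X Y : BorelContraction n K) : form X Y =
    ∑ i, ∑ j, if i ≠ j then toMatrix X i j * toMatrix Y j i else 0 := by
  have h1 : (lowerPart (toMatrix Y) * upperPart (toMatrix X)).trace =
      ∑ i, ∑ j, lowerPart (toMatrix Y) j i * upperPart (toMatrix X) i j := by
    simp only [Matrix.trace, Matrix.diag, Matrix.mul_apply]
    exact Finset.sum_comm
  rw [form, h1]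
  simp only [Matrix.trace, Matrix.diag, Matrix.mul_apply, ← Finset.sum_add_distrib,
    upperPart_apply, lowerPart_apply]
  refine Finset.sum_congr rfl fun i _ => Finset.sum_congr rfl fun j _ => ?_
  rcases lt_trichotomy i j with h | rfl | h
  · simp [h, h.le, h.ne, not_lt.mpr h.le, mul_comm]
  · simp
  · simp [h, h.le, h.ne', not_lt.mpr h.le]

/-- The superclass `1 + U^a X U^a`. -/
def superclass (X : BorelContraction n K) : Set (unipotentGroup n K) :=
  {g | ∃ a b : unipotentGroup n K,
    nilPart g = (a : (BorelContraction n K)ˣ) * X * (b : (BorelContraction n K)ˣ)}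

end BorelContraction

end Contraction

section RookPlacements

/-- A rook placement: a set of roots `(i, j)`, `i ≠ j`, with at most one root in any row and at
most one root in any column. -/
structure RookPlacement (n : ℕ) where
  roots : Finset (Fin n × Fin n)
  ne : ∀ γ ∈ roots, γ.1 ≠ γ.2
  row_inj : ∀ γ ∈ roots, ∀ δ ∈ roots, γ.1 = δ.1 → γ = δ
  col_inj : ∀ γ ∈ roots, ∀ δ ∈ roots, γ.2 = δ.2 → γ = δ

/-- A pair `(D, φ)`: a rook placement `D` with a map `φ : D → K^*`. -/
structure RookDatum (n : ℕ) (K : Type*) [Field K] where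
  D : RookPlacement n
  φ : {γ // γ ∈ D.roots} → Kˣ

/-- The rook placement `D^t`, consisting of the opposite roots `(j, i)` of the `(i, j) ∈ D`. -/
def RookPlacement.transpose {n : ℕ} (D : RookPlacement n) : RookPlacement n where
  roots := D.roots.map (Equiv.prodComm (Fin n) (Fin n)).toEmbedding
  ne := by
    intro γ hγ
    obtain ⟨δ, hδ, rfl⟩ := Finset.mem_map.mp hγ
    exact (D.ne δ hδ).symm
  row_inj := by
    intro γ hγ γ' hγ' h
    obtain ⟨δ, hδ, rfl⟩ := Finset.mem_map.mp hγ
    obtain ⟨δ', hδ', rfl⟩ := Finset.mem_map.mp hγ'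
    exact congrArg _ (D.col_inj δ hδ δ' hδ' h)
  col_inj := by
    intro γ hγ γ' hγ' h
    obtain ⟨δ, hδ, rfl⟩ := Finset.mem_map.mp hγ
    obtain ⟨δ', hδ', rfl⟩ := Finset.mem_map.mp hγ'
    exact congrArg _ (D.row_inj δ hδ δ' hδ' h)

theorem RookPlacement.swap_mem {n : ℕ} (D : RookPlacement n) {γ : Fin n × Fin n}
    (h : γ ∈ D.transpose.roots) : γ.swap ∈ D.roots := by
  obtain ⟨δ, hδ, rfl⟩ := Finset.mem_map.mp h
  exact hδ

/-- The set `S(γ)` of roots.  For `γ = (i, j)` with `i < j` it consists of the `(i, k)` with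
`i < k < j`; for `i > j` it consists of the `(i, k)` with `k < j` and the `(i, k)` with `i < k`. -/
def rootArm {n : ℕ} (γ : Fin n × Fin n) : Set (Fin n × Fin n) :=
  {α | α.1 = γ.1 ∧
    ((γ.1 < γ.2 ∧ γ.1 < α.2 ∧ α.2 < γ.2) ∨ (γ.2 < γ.1 ∧ (α.2 < γ.2 ∨ γ.1 < α.2)))}

namespace RookPlacement

open BorelContraction

variable {n : ℕ} {K : Type*} [Field K]

/-- The subspace `𝔘_D = ⋂_{γ ∈ D} 𝔘_γ`, where `𝔘_γ` is spanned by the matrix units `E_β`, `F_β`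
of `𝔘` with `β ∉ S(γ)`. -/
def radicalSub (D : RookPlacement n) (K : Type*) [Field K] :
    Submodule K (BorelContraction n K) where
  carrier := {X | X ∈ radical n K ∧
    ∀ γ ∈ D.roots, ∀ α ∈ rootArm γ, toMatrix X α.1 α.2 = 0}
  add_mem' := fun {X Y} hX hY => ⟨add_mem hX.1 hY.1, fun γ hγ α hα => by
    simp [hX.2 γ hγ α hα, hY.2 γ hγ α hα]⟩
  zero_mem' := ⟨zero_mem _, fun γ _ α _ => by simp⟩
  smul_mem' := fun c X hX => ⟨Submodule.smul_mem _ c hX.1, fun γ hγ α hα => by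
    simp [hX.2 γ hγ α hα]⟩

theorem radicalSub_mul_mem (D : RookPlacement n) (X Y : BorelContraction n K)
    (hX : X ∈ D.radicalSub K) : X * Y ∈ D.radicalSub K := by
  refine ⟨radical_mul_mem _ _ hX.1, fun γ hγ α hα => ?_⟩
  rw [toMatrix_mul_apply]
  refine Finset.sum_eq_zero fun k _ => ?_
  split_ifs with h
  · by_cases hk : k = α.1
    · rw [hk, hX.1 α.1, zero_mul]
    · have hm : (α.1, k) ∈ rootArm γ := by
        obtain ⟨h1, h2⟩ := hα
        refine ⟨h1, ?_⟩
        simp only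
        omega
      rw [hX.2 γ hγ _ hm, zero_mul]
  · rfl

theorem mul_apply_eq_zero (D : RookPlacement n) {X Y : BorelContraction n K}
    (hX : X ∈ D.radicalSub K) (hY : Y ∈ radical n K) {γ : Fin n × Fin n} (hγ : γ ∈ D.roots) :
    toMatrix (X * Y) γ.1 γ.2 = 0 := by
  rw [toMatrix_mul_apply]
  refine Finset.sum_eq_zero fun k _ => ?_
  split_ifs with h
  · by_cases hk : k = γ.1
    · rw [hk, hX.1 γ.1, zero_mul]
    by_cases hk' : k = γ.2
    · rw [hk', hY γ.2, mul_zero]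
    have hm : (γ.1, k) ∈ rootArm γ := by
      refine ⟨rfl, ?_⟩
      have := D.ne γ hγ
      simp only
      omega
    rw [hX.2 γ hγ _ hm, zero_mul]
  · rfl

/-- The subgroup `U_D = 1 + 𝔘_D` of `U^a`. -/
def subgroup (D : RookPlacement n) (K : Type*) [Field K] : Subgroup (unipotentGroup n K) where
  carrier := {u | nilPart u ∈ D.radicalSub K}
  one_mem' := by simp [nilPart_one]
  mul_mem' := fun {u v} hu hv => by
    simp only [Set.mem_ofPred_eq, nilPart_mul]
    exact add_mem (add_mem hu hv) (radicalSub_mul_mem D _ _ hu)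
  inv_mem' := fun {u} hu => by
    have h : nilPart u⁻¹ = -(nilPart u + nilPart u * nilPart u⁻¹) := by
      have := nilPart_mul u u⁻¹
      rw [mul_inv_cancel, nilPart_one] at this
      rw [eq_neg_iff_add_eq_zero, this]
      abel
    simp only [Set.mem_ofPred_eq]
    rw [h]
    exact neg_mem (add_mem hu (radicalSub_mul_mem D _ _ hu))

end RookPlacement

namespace RookDatum

open BorelContraction

variable {n : ℕ} {K : Type*} [Field K]

/-- The datum `(D^t, φ^t)` with `φ^t(γ) = φ(γ^t)`. -/
def transpose (d : RookDatum n K) : RookDatum n K where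
  D := d.D.transpose
  φ γ := d.φ ⟨γ.1.swap, d.D.swap_mem γ.2⟩

/-- The element `X_{D,φ} = ∑_{γ ∈ D_+} φ(γ) E_γ + ∑_{γ ∈ D_-} φ(γ) F_γ`. -/
def element (d : RookDatum n K) : BorelContraction n K :=
  ∑ γ : {γ // γ ∈ d.D.roots}, toMatrix.symm (Matrix.single γ.1.1 γ.1.2 (d.φ γ : K))

/-- The linear form `Λ_{D,φ}(Y) = (X_{D^t,φ^t}, Y)`. -/
def functional (d : RookDatum n K) (Y : BorelContraction n K) : K :=
  form d.transpose.element Y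

theorem form_element (d : RookDatum n K) (Y : BorelContraction n K) :
    form d.element Y =
      ∑ γ : {γ // γ ∈ d.D.roots}, (d.φ γ : K) * toMatrix Y γ.1.2 γ.1.1 := by
  simp only [form_eq_sum, element, map_sum, LinearEquiv.apply_symm_apply, Matrix.sum_apply,
    Finset.sum_mul, ← Finset.sum_filter]
  have hl : ∀ (i : Fin n) , (∑ j ∈ Finset.univ.filter (fun j => i ≠ j),
      ∑ γ : {γ // γ ∈ d.D.roots},
        Matrix.single γ.1.1 γ.1.2 (d.φ γ : K) i j * toMatrix Y j i) =
      ∑ γ : {γ // γ ∈ d.D.roots}, ∑ j ∈ Finset.univ.filter (fun j => i ≠ j),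
        Matrix.single γ.1.1 γ.1.2 (d.φ γ : K) i j * toMatrix Y j i :=
    fun i => Finset.sum_comm
  simp only [hl]
  rw [Finset.sum_comm]
  refine Finset.sum_congr rfl fun γ _ => ?_
  rw [Finset.sum_eq_single γ.1.1, Finset.sum_eq_single γ.1.2]
  · simp
  · intro j _ hj
    simp [hj.symm]
  · intro h
    exact absurd (by simpa using h) (d.D.ne _ γ.2)
  · intro i _ hi
    refine Finset.sum_eq_zero fun j _ => ?_
    simp [hi.symm]
  · simp

theorem functional_add (d : RookDatum n K) (Y Z : BorelContraction n K) :
    d.functional (Y + Z) = d.functional Y + d.functional Z := by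
  simp only [functional, form_element, map_add, Matrix.add_apply, mul_add,
    Finset.sum_add_distrib]

theorem functional_mul (d : RookDatum n K) {X Y : BorelContraction n K}
    (hX : X ∈ d.D.radicalSub K) (hY : Y ∈ radical n K) : d.functional (X * Y) = 0 := by
  rw [functional, form_element]
  refine Finset.sum_eq_zero fun γ _ => ?_
  have h := d.D.mul_apply_eq_zero hX hY (d.D.swap_mem γ.2)
  simp only [Prod.fst_swap, Prod.snd_swap] at h
  rw [h, mul_zero]

/-- The linear character `ξ_{D,φ}(1 + X) = ε^{Λ_{D,φ}(X)}` of `U_D`. -/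
def linearCharacter (ε : AddChar K ℂ) (d : RookDatum n K) : d.D.subgroup K →* ℂ where
  toFun u := ε (d.functional (nilPart (u : unipotentGroup n K)))
  map_one' := by
    have h : d.functional 0 = 0 := by
      have := d.functional_add 0 0
      simpa using this
    simp [nilPart_one, h]
  map_mul' u v := by
    rw [Subgroup.coe_mul, nilPart_mul, functional_add, functional_add,
      d.functional_mul u.2 (nilPart_mem _), add_zero, AddChar.map_add_eq_mul]

/-- The character `χ_{D,φ}` of `U^a`: the character of the representation induced from the one
dimensional representation of `U_D` on `ℂ` given by `ξ_{D,φ}`. -/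
noncomputable def character (ε : AddChar K ℂ) (d : RookDatum n K) : unipotentGroup n K → ℂ :=
  (Representation.ind (d.D.subgroup K).subtype
    ((Algebra.lmul ℂ ℂ : ℂ →* Module.End ℂ ℂ).comp (d.linearCharacter ε) :
      Representation ℂ (d.D.subgroup K) ℂ)).character

/-- The class `K_{D,φ} = 1 + U^a X_{D,φ} U^a`, the superclass of `u_{D,φ} = 1 + X_{D,φ}`. -/
def superclass (d : RookDatum n K) : Set (unipotentGroup n K) :=
  BorelContraction.superclass d.element

end RookDatum

end RookPlacements

/-!
Let `len i j` be the number of steps from `i` to `j` around the cycle `0, …, n - 1`. The contraction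
is the matrix algebra in which `E_{ik} E_{kj}` equals `E_{ij}` if `len i k + len k j = len i j`, and
`0` otherwise. So multiplication by an element of the radical moves entries to positions of larger
length, and clearing the longer entries in the row and the column of a nonzero entry leaves the
shorter ones alone. Working up from the shortest entries brings each orbit `U X U` to a rook matrix.
It is unique, and hence the sets `1 + U X_{D,φ} U` partition `U`.

Summing `ε(Λ(X u))` over `u ∈ U` gives `|U| ξ(1 + X)` if `1 + X ∈ U_D` and `0` otherwise, so the
Frobenius formula turns `χ_{D,φ}(1 + X)` into a multiple of `∑_{a, b ∈ U} ε(Λ_{D,φ}(a X b))`, which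
depends only on `U X U`. Two such sums are orthogonal because the linear forms `X ↦ Λ_{D,φ}(a X b)`
of distinct data are distinct: the form determines `(D, φ)` by the same uniqueness argument, applied
to the dual action.
-/

section InducedCharacter

open Representation

theorem isComplexCharacter_character {G V : Type*} [Group G] [AddCommGroup V] [Module ℂ V]
    [Module.Finite ℂ V] [Nontrivial V] (ρ : Representation ℂ G V) :
    IsComplexCharacter ρ.character := by
  let e := (Module.finBasis ℂ V).equivFun
  exact ⟨_, Module.finrank_pos (R := ℂ) (M := V), (e.conjRingEquiv : _ →* _).comp ρ,
    funext fun g => LinearMap.trace_conj' (ρ g) e⟩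

section CommRing

variable {k G H V : Type*} [CommRing k] [Group G] [Group H] [AddCommGroup V] [Module k V]
  (φ : H →* G) (ρ : Representation k H V)

theorem indV_mk_map_mul (h : H) (g : G) (v : V) :
    IndV.mk φ ρ (φ h * g) (ρ h v) = IndV.mk φ ρ g v := by
  have := Coinvariants.mk_self_apply (ρ := Representation.tprod ((leftRegular k G).comp φ) ρ) h
    (TensorProduct.tmul k (.single g 1) v)
  simpa using this

variable [Fintype H] [DecidableEq G]

theorem sum_fiber_mul_inv (h₀ : H) (y : G) (v : V) :
    ∑ h with φ h = y * (φ h₀)⁻¹, ρ h (ρ h₀ v) = ∑ h with φ h = y, ρ h v := by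
  simp only [Finset.sum_filter]
  refine Fintype.sum_equiv (Equiv.mulRight h₀) _ _ fun h => ?_
  simp [eq_mul_inv_iff_mul_eq]

/-- The component at `x` of the canonical map from the induced representation to the functions
`G → V`. It sends `⟦g ⊗ v⟧` to the sum of the `ρ h v` over all `h` with `φ h = x * g⁻¹`; for
injective `φ` this sum has at most one term. -/
noncomputable def indCoeff (x : G) : IndV φ ρ →ₗ[k] V :=
  Coinvariants.lift _ (TensorProduct.lift
    ((Finsupp.linearCombination k fun g : G => ∑ h with φ h = x * g⁻¹, ρ h) ∘ₗ
      (MonoidAlgebra.coeffLinearEquiv k).toLinearMap)) fun h₀ => by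
    ext g v
    simpa [mul_assoc] using sum_fiber_mul_inv φ ρ h₀ (x * g⁻¹) v

theorem indCoeff_mk (x g : G) (v : V) :
    indCoeff φ ρ x (IndV.mk φ ρ g v) = ∑ h with φ h = x * g⁻¹, ρ h v := by
  simp [indCoeff]

theorem sum_mk_indCoeff [Fintype G] (w : IndV φ ρ) :
    ∑ x, IndV.mk φ ρ x (indCoeff φ ρ x w) = (Fintype.card H : k) • w := by
  suffices ∑ x, IndV.mk φ ρ x ∘ₗ indCoeff φ ρ x = (Fintype.card H : k) • LinearMap.id by
    simpa using LinearMap.congr_fun this w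
  ext g v
  have hfiber (x : G) : IndV.mk φ ρ x (indCoeff φ ρ x (IndV.mk φ ρ g v)) =
      ∑ h with φ h * g = x, IndV.mk φ ρ g v := by
    simp only [indCoeff_mk, map_sum, eq_mul_inv_iff_mul_eq]
    refine Finset.sum_congr rfl fun h hh => ?_
    rw [← (Finset.mem_filter.mp hh).2, indV_mk_map_mul]
  calc (∑ x, IndV.mk φ ρ x ∘ₗ indCoeff φ ρ x) (IndV.mk φ ρ g v)
      = ∑ x, ∑ h with φ h * g = x, IndV.mk φ ρ g v := by
        rw [LinearMap.sum_apply]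
        exact Finset.sum_congr rfl fun x _ => hfiber x
    _ = (Fintype.card H : k) • IndV.mk φ ρ g v := by
        rw [Finset.sum_fiberwise, Finset.sum_const, Finset.card_univ, Nat.cast_smul_eq_nsmul]

end CommRing

theorem nontrivial_indV {k G H V : Type*} [CommRing k] [Group G] [Group H] [AddCommGroup V]
    [Module k V] [Finite H] [Nontrivial V] {φ : H →* G} (hφ : Function.Injective φ)
    (ρ : Representation k H V) : Nontrivial (IndV φ ρ) := by
  classical
  have := Fintype.ofFinite H
  obtain ⟨v, hv⟩ := exists_ne (0 : V)
  refine ⟨IndV.mk φ ρ 1 v, 0, fun h => hv ?_⟩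
  have hcoeff := congrArg (indCoeff φ ρ 1) h
  rw [indCoeff_mk, map_zero, inv_one, mul_one, Finset.sum_eq_single 1] at hcoeff
  · simpa only [map_one, Module.End.one_apply] using hcoeff
  · exact fun h hh h1 => absurd ((map_eq_one_iff φ hφ).mp (Finset.mem_filter.mp hh).2) h1
  · simp

section Field

variable {k G H V : Type*} [Field k] [Group G] [Group H] [Fintype G] [Fintype H] [DecidableEq G]
  [AddCommGroup V] [Module k V] [Module.Finite k V] (φ : H →* G) (ρ : Representation k H V)

theorem character_ind (hcard : (Fintype.card H : k) ≠ 0) (g : G) :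
    (ind φ ρ).character g =
      (Fintype.card H : k)⁻¹ * ∑ x, ∑ h with φ h = x * g * x⁻¹, ρ.character h := by
  have hcoeff (x : G) : indCoeff φ ρ x ∘ₗ ind φ ρ g ∘ₗ IndV.mk φ ρ x =
      ∑ h with φ h = x * g * x⁻¹, ρ h := by
    ext v
    rw [LinearMap.comp_apply, LinearMap.comp_apply, ind_mk, indCoeff_mk, LinearMap.sum_apply]
    simp only [mul_inv_rev, inv_inv, mul_assoc]
  have hdecomp : (Fintype.card H : k) • ind φ ρ g =
      ∑ x, (ind φ ρ g ∘ₗ IndV.mk φ ρ x) ∘ₗ indCoeff φ ρ x := by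
    refine LinearMap.ext fun w => ?_
    rw [LinearMap.smul_apply, ← map_smul, ← sum_mk_indCoeff φ ρ w, map_sum, LinearMap.sum_apply]
    rfl
  rw [eq_inv_mul_iff_mul_eq₀ hcard, character, ← smul_eq_mul, ← map_smul, hdecomp, map_sum]
  refine Finset.sum_congr rfl fun x _ => ?_
  rw [LinearMap.trace_comp_comm', hcoeff, map_sum]
  rfl

end Field
end InducedCharacter

section CharacterInner

variable {G α β : Type*} [Fintype G] [Fintype α] [Fintype β]

theorem characterInner_mul_sum_mul_sum (c c' : ℂ) (A : α → G → ℂ) (B : β → G → ℂ) :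
    characterInner (fun g => c * ∑ p, A p g) (fun g => c' * ∑ q, B q g) =
      c * starRingEnd ℂ c' * ∑ p, ∑ q, characterInner (A p) (B q) := by
  have hswap : ∑ p, ∑ q, ∑ g, A p g * starRingEnd ℂ (B q g) =
      ∑ g, (∑ p, A p g) * ∑ q, starRingEnd ℂ (B q g) := by
    rw [Finset.sum_congr rfl fun _ _ => Finset.sum_comm, Finset.sum_comm]
    simp only [Finset.sum_mul_sum]
  simp only [characterInner, map_mul, map_sum, ← Finset.mul_sum, hswap]
  rw [mul_left_comm, Finset.mul_sum (a := c * _)]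
  simp only [mul_mul_mul_comm]

end CharacterInner

theorem sum_addChar_linearMap_eq_zero {K V R : Type*} [Field K] [AddCommGroup V] [Module K V]
    [Fintype V] [CommRing R] [IsDomain R] {ε : AddChar K R} (hε : ε ≠ 1) {f : V →ₗ[K] K}
    (hf : f ≠ 0) : ∑ v, ε (f v) = 0 := by
  refine AddChar.sum_eq_zero_of_ne_one (ψ := ε.compAddMonoidHom f.toAddMonoidHom) fun h => hε ?_
  ext t
  obtain ⟨v, rfl⟩ := LinearMap.surjective hf t
  exact DFunLike.congr_fun h v

section TwoSidedOrbit

variable {M : Type*} [Monoid M] {U : Subgroup Mˣ} {x y z : M}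

/-- `y` lies in the two-sided orbit `U x U` of `x`. -/
def InTwoSidedOrbit (U : Subgroup Mˣ) (x y : M) : Prop :=
  ∃ a b : U, y = (a : Mˣ) * x * (b : Mˣ)

namespace InTwoSidedOrbit

theorem refl (x : M) : InTwoSidedOrbit U x x := ⟨1, 1, by simp⟩

theorem symm (h : InTwoSidedOrbit U x y) : InTwoSidedOrbit U y x := by
  obtain ⟨a, b, rfl⟩ := h
  exact ⟨a⁻¹, b⁻¹, by simp [mul_assoc]⟩

theorem trans (h : InTwoSidedOrbit U x y) (h' : InTwoSidedOrbit U y z) :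
    InTwoSidedOrbit U x z := by
  obtain ⟨a, b, rfl⟩ := h
  obtain ⟨c, d, rfl⟩ := h'
  exact ⟨c * a, b * d, by simp [mul_assoc]⟩

theorem sum_eq {R : Type*} [AddCommMonoid R] [Fintype U] (h : InTwoSidedOrbit U x y)
    (f : M → R) :
    ∑ p : U × U, f ((p.1 : Mˣ) * x * (p.2 : Mˣ)) =
      ∑ p : U × U, f ((p.1 : Mˣ) * y * (p.2 : Mˣ)) := by
  obtain ⟨a, b, rfl⟩ := h
  refine (Fintype.sum_equiv ((Equiv.mulRight a).prodCongr (Equiv.mulLeft b)) _ _ fun p => ?_).symm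
  simp [mul_assoc]

end InTwoSidedOrbit

end TwoSidedOrbit

section RookMatrix

variable {ι κ R : Type*} [Zero R]

/-- A rook matrix: at most one nonzero entry in any row and at most one in any column. -/
structure IsRookMatrix (M : Matrix ι κ R) : Prop where
  row : ∀ ⦃i j k⦄, M i j ≠ 0 → M i k ≠ 0 → j = k
  col : ∀ ⦃i j k⦄, M i k ≠ 0 → M j k ≠ 0 → i = j

theorem isRookMatrix_zero : IsRookMatrix (0 : Matrix ι κ R) where
  row _ _ _ h := absurd rfl h
  col _ _ _ h := absurd rfl h

namespace IsRookMatrix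

theorem apply_eq_zero_of_row {M : Matrix ι κ R} (hM : IsRookMatrix M) {i : ι} {j k : κ}
    (hij : M i j ≠ 0) (hk : k ≠ j) : M i k = 0 :=
  not_not.mp fun h => hk (hM.row h hij)

theorem apply_eq_zero_of_col {M : Matrix ι κ R} (hM : IsRookMatrix M) {i k : ι} {j : κ}
    (hij : M i j ≠ 0) (hk : k ≠ i) : M k j = 0 :=
  not_not.mp fun h => hk (hM.col h hij)

theorem eq_of_forall_lt_eq_zero [Finite ι] [Finite κ] {α : Type*} [Preorder α] (ℓ : ι → κ → α)
    {M M' : Matrix ι κ R} (hM : IsRookMatrix M) (hM' : IsRookMatrix M')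
    (h : ∀ i j, (∀ k, ℓ k j < ℓ i j → M k j = 0) → (∀ k, ℓ i k < ℓ i j → M' i k = 0) →
      M i j = M' i j) : M = M' := by
  suffices H : ∀ p : ι × κ, M p.1 p.2 = M' p.1 p.2 from Matrix.ext fun i j => H (i, j)
  intro p
  let _ : Preorder (ι × κ) := Preorder.lift (Function.uncurry ℓ)
  induction p using WellFoundedLT.induction with | _ p ih
  obtain ⟨i, j⟩ := p
  have ihcol (k : ι) (hk : ℓ k j < ℓ i j) : M k j = M' k j := ih (k, j) hk
  have ihrow (k : κ) (hk : ℓ i k < ℓ i j) : M i k = M' i k := ih (i, k) hk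
  by_cases hij : M i j = 0
  · by_cases hij' : M' i j = 0
    · exact hij.trans hij'.symm
    · exact h i j
        (fun k hk => (ihcol k hk).trans
          (hM'.apply_eq_zero_of_col hij' fun e => (lt_irrefl _ (e ▸ hk))))
        fun k hk => hM'.apply_eq_zero_of_row hij' fun e => (lt_irrefl _ (e ▸ hk))
  · exact h i j
      (fun k hk => hM.apply_eq_zero_of_col hij fun e => (lt_irrefl _ (e ▸ hk)))
      fun k hk => (ihrow k hk).symm.trans
        (hM.apply_eq_zero_of_row hij fun e => (lt_irrefl _ (e ▸ hk)))

end IsRookMatrix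

end RookMatrix

section CyclicLength

variable {n : ℕ}

/-- The length of the cyclic interval from `i` to `j`, that is, the residue of `j - i`
modulo `n`. -/
def cyclicLength (i j : Fin n) : ℕ :=
  if i ≤ j then (j : ℕ) - i else n + j - i

theorem cyclicLength_lt (i j : Fin n) : cyclicLength i j < n := by
  unfold cyclicLength
  split_ifs <;> omega

@[simp]
theorem cyclicLength_self (i : Fin n) : cyclicLength i i = 0 := by
  simp [cyclicLength]

theorem cyclicLength_eq_zero {i j : Fin n} (h : cyclicLength i j = 0) : i = j := by
  unfold cyclicLength at h
  split_ifs at h <;> omega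

theorem cyclicLength_left_inj {i j k : Fin n} (h : cyclicLength i k = cyclicLength j k) :
    i = j := by
  unfold cyclicLength at h
  split_ifs at h <;> omega

theorem cyclicLength_right_inj {i j k : Fin n} (h : cyclicLength i j = cyclicLength i k) :
    j = k := by
  unfold cyclicLength at h
  split_ifs at h <;> omega

theorem cyclicLength_add_iff (i k j : Fin n) :
    cyclicLength i k + cyclicLength k j = cyclicLength i j ↔
      (i ≤ k ∧ k ≤ j) ∨ (j < i ∧ (i ≤ k ∨ k ≤ j)) := by
  unfold cyclicLength
  split_ifs <;> omega

theorem cyclicLength_add_of_le_left {i k j : Fin n} (h : cyclicLength i k ≤ cyclicLength i j) :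
    cyclicLength i k + cyclicLength k j = cyclicLength i j := by
  unfold cyclicLength at h ⊢
  split_ifs at h ⊢ <;> omega

theorem cyclicLength_add_of_le_right {i k j : Fin n} (h : cyclicLength k j ≤ cyclicLength i j) :
    cyclicLength i k + cyclicLength k j = cyclicLength i j := by
  unfold cyclicLength at h ⊢
  split_ifs at h ⊢ <;> omega

theorem cyclicLength_pos {i j : Fin n} (h : i ≠ j) : 0 < cyclicLength i j :=
  Nat.pos_of_ne_zero (mt cyclicLength_eq_zero h)

theorem mem_rootArm_iff {γ α : Fin n × Fin n} : α ∈ rootArm γ ↔ α.1 = γ.1 ∧ α.2 ≠ γ.1 ∧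
    α.2 ≠ γ.2 ∧ cyclicLength γ.1 α.2 + cyclicLength α.2 γ.2 = cyclicLength γ.1 γ.2 := by
  rw [cyclicLength_add_iff]
  change _ ∧ _ ↔ _
  refine and_congr_right fun _ => ?_
  omega

end CyclicLength

section LengthProfile

variable {n : ℕ} {R : Type*} [Zero R]

/-- The numbers of nonzero entries of a matrix in positions of cyclic length `0, …, n - 1`, in the
lexicographic order that compares short positions first. This is the termination measure of the
elimination procedure. -/
noncomputable def lengthProfile (M : Matrix (Fin n) (Fin n) R) : Lex (Fin n → ℕ) :=
  toLex fun m => {p : Fin n × Fin n | cyclicLength p.1 p.2 = m ∧ M p.1 p.2 ≠ 0}.ncard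

theorem lengthProfile_lt {M M' : Matrix (Fin n) (Fin n) R} {i j : Fin n} (hM : M i j ≠ 0)
    (hM' : M' i j = 0) (hother : ∀ k l, cyclicLength k l ≤ cyclicLength i j → (k, l) ≠ (i, j) →
      M' k l = M k l) : lengthProfile M' < lengthProfile M := by
  refine ⟨⟨cyclicLength i j, cyclicLength_lt i j⟩, fun m hm => ?_, ?_⟩
  · have hm' : (m : ℕ) < cyclicLength i j := hm
    refine congrArg Set.ncard (Set.ext fun ⟨k, l⟩ => and_congr_right fun hkl => ?_)
    simp only at hkl
    rw [hother k l (by omega) (by rintro ⟨⟩; omega)]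
  · refine Set.ncard_lt_ncard ⟨?_, fun h => (h (a := (i, j)) ⟨rfl, hM⟩).2 hM'⟩
    rintro ⟨k, l⟩ ⟨hkl, hne⟩
    exact ⟨hkl, by rwa [← hother k l hkl.le (by rintro ⟨⟩; exact hne hM')]⟩

end LengthProfile

namespace BorelContraction

variable {n : ℕ} {K : Type*} [Field K]

instance : IsScalarTower K (BorelContraction n K) (BorelContraction n K) where
  smul_assoc c X Y := by
    apply toMatrix.injective
    simp only [smul_eq_mul, map_smul, toMatrix_mul, Matrix.smul_mul, smul_add, map_add]

instance : SMulCommClass K (BorelContraction n K) (BorelContraction n K) where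
  smul_comm c X Y := by
    apply toMatrix.injective
    simp only [smul_eq_mul, map_smul, toMatrix_mul, Matrix.mul_smul, smul_add, map_add]

section Multiplication

theorem toMatrix_mul_eq_sum (X Y : BorelContraction n K) (i j : Fin n) :
    toMatrix (X * Y) i j = ∑ k : Fin n,
      if cyclicLength i k + cyclicLength k j = cyclicLength i j then
        toMatrix X i k * toMatrix Y k j else 0 := by
  simp only [toMatrix_mul_apply, cyclicLength_add_iff]

/-- The basis element `E_ij` or `F_ij`. -/
def matrixUnit (i j : Fin n) : BorelContraction n K := toMatrix.symm (Matrix.single i j 1)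

theorem toMatrix_matrixUnit (i j : Fin n) :
    toMatrix (matrixUnit i j : BorelContraction n K) = Matrix.single i j 1 := rfl

theorem matrixUnit_mem_radical {i j : Fin n} (h : i ≠ j) :
    (matrixUnit i j : BorelContraction n K) ∈ radical n K := fun k => by
  rw [toMatrix_matrixUnit]
  exact Matrix.single_apply_of_ne _ _ _ _ _ fun hk => h (hk.1.trans hk.2.symm)

theorem toMatrix_mul_matrixUnit (X : BorelContraction n K) (k l i j : Fin n) :
    toMatrix (X * matrixUnit k l) i j =
      if j = l ∧ cyclicLength i k + cyclicLength k l = cyclicLength i l then toMatrix X i k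
      else 0 := by
  rw [toMatrix_mul_eq_sum, Fintype.sum_eq_single k]
  · by_cases h : j = l
    · subst h; simp [toMatrix_matrixUnit]
    · simp [toMatrix_matrixUnit, h, Ne.symm h]
  · intro m hm
    simp [toMatrix_matrixUnit, Ne.symm hm]

theorem toMatrix_matrixUnit_mul (X : BorelContraction n K) (k l i j : Fin n) :
    toMatrix (matrixUnit k l * X) i j =
      if i = k ∧ cyclicLength k l + cyclicLength l j = cyclicLength k j then toMatrix X l j
      else 0 := by
  rw [toMatrix_mul_eq_sum, Fintype.sum_eq_single l]
  · by_cases h : i = k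
    · subst h; simp [toMatrix_matrixUnit]
    · simp [toMatrix_matrixUnit, h, Ne.symm h]
  · intro m hm
    simp [toMatrix_matrixUnit, Ne.symm hm]

variable {X N : BorelContraction n K} {i j : Fin n}

theorem toMatrix_radical_mul_eq_zero (hN : N ∈ radical n K)
    (h : ∀ k, cyclicLength k j < cyclicLength i j → toMatrix X k j = 0) :
    toMatrix (N * X) i j = 0 := by
  rw [toMatrix_mul_eq_sum]
  refine Finset.sum_eq_zero fun k _ => ite_eq_right_iff.mpr fun hk => ?_
  obtain rfl | hik := eq_or_ne i k
  · rw [hN i, zero_mul]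
  · rw [h k (by have := cyclicLength_pos hik; omega), mul_zero]

theorem toMatrix_mul_radical_eq_zero (hN : N ∈ radical n K)
    (h : ∀ k, cyclicLength i k < cyclicLength i j → toMatrix X i k = 0) :
    toMatrix (X * N) i j = 0 := by
  rw [toMatrix_mul_eq_sum]
  refine Finset.sum_eq_zero fun k _ => ite_eq_right_iff.mpr fun hk => ?_
  obtain rfl | hkj := eq_or_ne k j
  · rw [hN k, mul_zero]
  · rw [h k (by have := cyclicLength_pos hkj; omega), zero_mul]

end Multiplication

section UnipotentGroup

variable {X N : BorelContraction n K}

theorem mul_radical_mem (hN : N ∈ radical n K) : X * N ∈ radical n K := fun i =>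
  toMatrix_mul_radical_eq_zero hN fun k hk => by simp at hk

theorem toMatrix_pow_eq_zero (hN : N ∈ radical n K) (m : ℕ) {i j : Fin n}
    (h : cyclicLength i j < m) : toMatrix (N ^ m) i j = 0 := by
  induction m generalizing j with
  | zero => omega
  | succ m ih =>
    rw [pow_succ]
    exact toMatrix_mul_radical_eq_zero hN fun k hk => ih (by omega)

theorem isNilpotent_of_mem_radical (hN : N ∈ radical n K) : IsNilpotent N :=
  ⟨n, toMatrix.injective <| Matrix.ext fun i j => by
    rw [toMatrix_pow_eq_zero hN n (cyclicLength_lt i j), map_zero, Matrix.zero_apply]⟩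

theorem val_eq_one_add_nilPart (u : unipotentGroup n K) :
    ((u : (BorelContraction n K)ˣ) : BorelContraction n K) = 1 + nilPart u :=
  (add_sub_cancel _ _).symm

/-- The bijection `1 + X ↦ X` from `U^a` to `𝔘`. -/
noncomputable def nilPartEquiv : unipotentGroup n K ≃ radical n K where
  toFun u := ⟨nilPart u, nilPart_mem u⟩
  invFun X := ⟨(isNilpotent_of_mem_radical X.2).isUnit_one_add.unit, by
    change _ - 1 ∈ radical n K
    simp⟩
  left_inv u := Subtype.ext <| Units.ext <| by simp [nilPart]
  right_inv X := Subtype.ext <| by simp [nilPart]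

theorem nilPart_nilPartEquiv_symm (X : radical n K) : nilPart (nilPartEquiv.symm X) = X :=
  congrArg Subtype.val (nilPartEquiv.apply_symm_apply X)

theorem nilPart_eq_zero_iff {u : unipotentGroup n K} : nilPart u = 0 ↔ u = 1 := by
  rw [nilPart, sub_eq_zero, ← Units.val_one, Units.val_inj, OneMemClass.coe_eq_one]

theorem nilPart_conj (x g : unipotentGroup n K) :
    nilPart (x * g * x⁻¹) = (x : (BorelContraction n K)ˣ) * nilPart g *
      ((x⁻¹ : unipotentGroup n K) : (BorelContraction n K)ˣ) := by
  simp [nilPart, mul_sub, sub_mul]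

theorem sum_addChar_nilPart_eq_zero [Finite K] {ε : AddChar K ℂ} (hε : ε ≠ 1)
    {f : BorelContraction n K →ₗ[K] K} (hf : ∃ X ∈ radical n K, f X ≠ 0) :
    ∑ u : unipotentGroup n K, ε (f (nilPart u)) = 0 := by
  have := Fintype.ofFinite (radical n K)
  obtain ⟨X, hX, hfX⟩ := hf
  have hne : f.domRestrict (radical n K) ≠ 0 := fun h => hfX (LinearMap.congr_fun h ⟨X, hX⟩)
  rw [← sum_addChar_linearMap_eq_zero hε hne]
  exact Fintype.sum_equiv nilPartEquiv _ _ fun u => rfl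

end UnipotentGroup

section Orbit

variable {X Y N : BorelContraction n K}

theorem mem_radical_of_inTwoSidedOrbit (h : InTwoSidedOrbit (unipotentGroup n K) X Y)
    (hX : X ∈ radical n K) : Y ∈ radical n K := by
  obtain ⟨a, b, rfl⟩ := h
  exact radical_mul_mem _ _ (mul_radical_mem hX)

theorem inTwoSidedOrbit_add_mul_radical (X : BorelContraction n K) (hN : N ∈ radical n K) :
    InTwoSidedOrbit (unipotentGroup n K) X (X + X * N) := by
  refine ⟨1, nilPartEquiv.symm ⟨N, hN⟩, ?_⟩
  rw [val_eq_one_add_nilPart (nilPartEquiv.symm _), nilPart_nilPartEquiv_symm]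
  simp [mul_add]

theorem inTwoSidedOrbit_add_radical_mul (X : BorelContraction n K) (hN : N ∈ radical n K) :
    InTwoSidedOrbit (unipotentGroup n K) X (X + N * X) := by
  refine ⟨nilPartEquiv.symm ⟨N, hN⟩, 1, ?_⟩
  rw [val_eq_one_add_nilPart (nilPartEquiv.symm _), nilPart_nilPartEquiv_symm]
  simp [add_mul]

theorem eq_of_inTwoSidedOrbit (hX : IsRookMatrix (toMatrix X)) (hY : IsRookMatrix (toMatrix Y))
    (h : InTwoSidedOrbit (unipotentGroup n K) X Y) : X = Y := by
  obtain ⟨a, b, rfl⟩ := h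
  set Y : BorelContraction n K := (a : (BorelContraction n K)ˣ) * X * (b : (BorelContraction n K)ˣ)
  have hXY : X + nilPart a * X = Y + Y * nilPart b⁻¹ := by
    simp [Y, nilPart, mul_sub, sub_mul, mul_assoc]
  refine toMatrix.injective (hX.eq_of_forall_lt_eq_zero cyclicLength hY fun i j hcol hrow => ?_)
  have hij := congrFun (congrFun (congrArg toMatrix hXY) i) j
  rwa [map_add, map_add, Matrix.add_apply, Matrix.add_apply,
    toMatrix_radical_mul_eq_zero (nilPart_mem a) hcol,
    toMatrix_mul_radical_eq_zero (nilPart_mem b⁻¹) hrow, add_zero, add_zero] at hij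

end Orbit

section Elimination

variable {X : BorelContraction n K} {i j k l : Fin n}

theorem exists_lengthProfile_lt_of_row (hij : toMatrix X i j ≠ 0) (hil : toMatrix X i l ≠ 0)
    (hlt : cyclicLength i j < cyclicLength i l)
    (hcol : ∀ a, cyclicLength a j < cyclicLength i j → toMatrix X a j = 0) :
    ∃ Y, InTwoSidedOrbit (unipotentGroup n K) X Y ∧
      lengthProfile (toMatrix Y) < lengthProfile (toMatrix X) := by
  have hjl : j ≠ l := by rintro rfl; exact hlt.false
  let c := -(toMatrix X i l / toMatrix X i j)
  refine ⟨_, inTwoSidedOrbit_add_mul_radical X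
    (Submodule.smul_mem _ c (matrixUnit_mem_radical hjl)), lengthProfile_lt hil ?_ ?_⟩
  · have hadd := cyclicLength_add_of_le_left hlt.le
    simp [mul_smul_comm, toMatrix_mul_matrixUnit, hadd, c, hij]
  · intro a b hab hne
    suffices ¬(b = l ∧ cyclicLength a j + cyclicLength j l = cyclicLength a l) ∨
        toMatrix X a j = 0 by
      rcases this with h | h <;> simp [mul_smul_comm, toMatrix_mul_matrixUnit, h]
    refine or_iff_not_imp_left.mpr fun h => ?_
    obtain ⟨rfl, hadd⟩ := not_not.mp h
    have hai : cyclicLength a j ≠ cyclicLength i j := fun e => hne (by rw [cyclicLength_left_inj e])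
    exact hcol a (lt_of_le_of_ne (by linarith [cyclicLength_add_of_le_left hlt.le]) hai)

theorem exists_lengthProfile_lt_of_col (hij : toMatrix X i j ≠ 0) (hkj : toMatrix X k j ≠ 0)
    (hlt : cyclicLength i j < cyclicLength k j)
    (hrow : ∀ b, cyclicLength i b < cyclicLength i j → toMatrix X i b = 0) :
    ∃ Y, InTwoSidedOrbit (unipotentGroup n K) X Y ∧
      lengthProfile (toMatrix Y) < lengthProfile (toMatrix X) := by
  have hki : k ≠ i := by rintro rfl; exact hlt.false
  let c := -(toMatrix X k j / toMatrix X i j)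
  refine ⟨_, inTwoSidedOrbit_add_radical_mul X
    (Submodule.smul_mem _ c (matrixUnit_mem_radical hki)), lengthProfile_lt hkj ?_ ?_⟩
  · have hadd := cyclicLength_add_of_le_right hlt.le
    simp [smul_mul_assoc, toMatrix_matrixUnit_mul, hadd, c, hij]
  · intro a b hab hne
    suffices ¬(a = k ∧ cyclicLength k i + cyclicLength i b = cyclicLength k b) ∨
        toMatrix X i b = 0 by
      rcases this with h | h <;> simp [smul_mul_assoc, toMatrix_matrixUnit_mul, h]
    refine or_iff_not_imp_left.mpr fun h => ?_
    obtain ⟨rfl, hadd⟩ := not_not.mp h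
    have hbj : cyclicLength i b ≠ cyclicLength i j :=
      fun e => hne (by rw [cyclicLength_right_inj e])
    exact hrow b (lt_of_le_of_ne (by linarith [cyclicLength_add_of_le_right hlt.le]) hbj)

theorem isRookMatrix_of_forall_not_lengthProfile_lt
    (hmin : ∀ Y, InTwoSidedOrbit (unipotentGroup n K) X Y →
      ¬ lengthProfile (toMatrix Y) < lengthProfile (toMatrix X)) :
    IsRookMatrix (toMatrix X) := by
  have hlong (L : ℕ) : ∀ i j, cyclicLength i j = L → toMatrix X i j ≠ 0 →
      (∀ l, cyclicLength i j < cyclicLength i l → toMatrix X i l = 0) ∧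
        ∀ k, cyclicLength i j < cyclicLength k j → toMatrix X k j = 0 := by
    induction L using Nat.strong_induction_on with | _ L ih
    rintro i j rfl hij
    refine ⟨fun l hlt => by_contra fun hil => ?_, fun k hlt => by_contra fun hkj => ?_⟩
    · obtain ⟨Y, hY, hYX⟩ := exists_lengthProfile_lt_of_row hij hil hlt fun a ha =>
        by_contra fun haj => hij ((ih _ ha a j rfl haj).2 i ha)
      exact hmin Y hY hYX
    · obtain ⟨Y, hY, hYX⟩ := exists_lengthProfile_lt_of_col hij hkj hlt fun b hb =>
        by_contra fun hib => hij ((ih _ hb i b rfl hib).1 j hb)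
      exact hmin Y hY hYX
  constructor
  · intro i j k hj hk
    rcases lt_trichotomy (cyclicLength i j) (cyclicLength i k) with hl | hl | hl
    · exact absurd ((hlong _ i j rfl hj).1 k hl) hk
    · exact cyclicLength_right_inj hl
    · exact absurd ((hlong _ i k rfl hk).1 j hl) hj
  · intro i j k hi hj
    rcases lt_trichotomy (cyclicLength i k) (cyclicLength j k) with hl | hl | hl
    · exact absurd ((hlong _ i k rfl hi).2 j hl) hj
    · exact cyclicLength_left_inj hl
    · exact absurd ((hlong _ j k rfl hj).2 i hl) hi

theorem exists_inTwoSidedOrbit_isRookMatrix (X : BorelContraction n K) :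
    ∃ Y, InTwoSidedOrbit (unipotentGroup n K) X Y ∧ IsRookMatrix (toMatrix Y) := by
  obtain ⟨Y, hY, hmin⟩ := (InvImage.wf (fun Y => lengthProfile (toMatrix Y)) wellFounded_lt).has_min
    {Y | InTwoSidedOrbit (unipotentGroup n K) X Y} ⟨X, .refl X⟩
  exact ⟨Y, hY, isRookMatrix_of_forall_not_lengthProfile_lt fun Z hZ => hmin Z (hY.trans hZ)⟩

end Elimination

section EntryForm

/-- The linear form on the Borel contraction with coefficient `M i j` at the `(i, j)` entry. -/
def entryForm (M : Matrix (Fin n) (Fin n) K) : BorelContraction n K →ₗ[K] K :=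
  ∑ i, ∑ j, M i j • (Matrix.entryLinearMap K K i j ∘ₗ toMatrix.toLinearMap)

variable {M M' : Matrix (Fin n) (Fin n) K}

theorem entryForm_apply (M : Matrix (Fin n) (Fin n) K) (X : BorelContraction n K) :
    entryForm M X = ∑ i, ∑ j, M i j * toMatrix X i j := by
  simp [entryForm]

theorem entryForm_matrixUnit (M : Matrix (Fin n) (Fin n) K) (k l : Fin n) :
    entryForm M (matrixUnit k l) = M k l := by
  rw [entryForm_apply, Fintype.sum_eq_single k, Fintype.sum_eq_single l] <;>
    simp +contextual [toMatrix_matrixUnit, eq_comm]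

theorem entryForm_mul_matrixUnit (M : Matrix (Fin n) (Fin n) K) (X : BorelContraction n K)
    (k l : Fin n) : entryForm M (X * matrixUnit k l) = ∑ i,
      if cyclicLength i k + cyclicLength k l = cyclicLength i l then M i l * toMatrix X i k
      else 0 := by
  rw [entryForm_apply]
  refine Finset.sum_congr rfl fun i _ => ?_
  rw [Fintype.sum_eq_single l] <;> simp +contextual [toMatrix_mul_matrixUnit]

theorem entryForm_matrixUnit_mul (M : Matrix (Fin n) (Fin n) K) (X : BorelContraction n K)
    (k l : Fin n) : entryForm M (matrixUnit k l * X) = ∑ j,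
      if cyclicLength k l + cyclicLength l j = cyclicLength k j then M k j * toMatrix X l j
      else 0 := by
  rw [entryForm_apply, Fintype.sum_eq_single k] <;>
    simp +contextual [toMatrix_matrixUnit_mul]

variable {N : BorelContraction n K} {k l : Fin n}

theorem entryForm_radical_mul_matrixUnit_eq_zero (hN : N ∈ radical n K)
    (h : ∀ i, cyclicLength k l < cyclicLength i l → M i l = 0) :
    entryForm M (N * matrixUnit k l) = 0 := by
  rw [entryForm_mul_matrixUnit]
  refine Finset.sum_eq_zero fun i _ => ite_eq_right_iff.mpr fun hi => ?_
  obtain rfl | hik := eq_or_ne i k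
  · rw [hN i, mul_zero]
  · rw [h i (by have := cyclicLength_pos hik; omega), zero_mul]

theorem entryForm_matrixUnit_mul_radical_eq_zero (hN : N ∈ radical n K)
    (h : ∀ j, cyclicLength k l < cyclicLength k j → M k j = 0) :
    entryForm M (matrixUnit k l * N) = 0 := by
  rw [entryForm_matrixUnit_mul]
  refine Finset.sum_eq_zero fun j _ => ite_eq_right_iff.mpr fun hj => ?_
  obtain rfl | hlj := eq_or_ne l j
  · rw [hN l, mul_zero]
  · rw [h j (by have := cyclicLength_pos hlj; omega), zero_mul]

theorem eq_of_entryForm_mul_eq (hM : IsRookMatrix M) (hM' : IsRookMatrix M')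
    (hdiag : ∀ i, M i i = 0) (hdiag' : ∀ i, M' i i = 0) (a b : unipotentGroup n K)
    (h : ∀ X ∈ radical n K, entryForm M (X * (b : (BorelContraction n K)ˣ)) =
      entryForm M' ((a : (BorelContraction n K)ˣ) * X)) : M = M' := by
  -- The group moves the coefficients of a linear form to shorter positions: hence the dual order.
  refine (hM'.eq_of_forall_lt_eq_zero (fun k l => OrderDual.toDual (cyclicLength k l)) hM
    fun k l hcol hrow => ?_).symm
  obtain rfl | hkl := eq_or_ne k l
  · rw [hdiag, hdiag']
  have hunit := h (matrixUnit k l) (matrixUnit_mem_radical hkl)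
  rw [val_eq_one_add_nilPart a, val_eq_one_add_nilPart b, mul_add, add_mul, mul_one, one_mul,
    map_add, map_add, entryForm_matrixUnit, entryForm_matrixUnit,
    entryForm_matrixUnit_mul_radical_eq_zero (nilPart_mem b) hrow,
    entryForm_radical_mul_matrixUnit_eq_zero (nilPart_mem a) hcol, add_zero, add_zero] at hunit
  exact hunit.symm

end EntryForm

end BorelContraction

namespace RookDatum

open BorelContraction

variable {n : ℕ} {K : Type*} [Field K]

section Superclass

theorem toMatrix_element (d : RookDatum n K) (i j : Fin n) :
    toMatrix d.element i j = if h : (i, j) ∈ d.D.roots then (d.φ ⟨(i, j), h⟩ : K) else 0 := by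
  rw [element, map_sum, Matrix.sum_apply]
  have hsingle (γ : {γ // γ ∈ d.D.roots}) (hγ : γ.1 ≠ (i, j)) :
      toMatrix (toMatrix.symm (Matrix.single γ.1.1 γ.1.2 (d.φ γ : K))) i j = 0 := by
    rw [LinearEquiv.apply_symm_apply]
    exact Matrix.single_apply_of_ne _ _ _ _ _ fun h => hγ (Prod.ext h.1 h.2)
  split_ifs with h
  · rw [Fintype.sum_eq_single ⟨(i, j), h⟩ fun γ hγ => hsingle γ fun e => hγ (Subtype.ext e)]
    simp
  · exact Finset.sum_eq_zero fun γ _ => hsingle γ fun e => h (e ▸ γ.2)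

theorem toMatrix_element_ne_zero_iff (d : RookDatum n K) (i j : Fin n) :
    toMatrix d.element i j ≠ 0 ↔ (i, j) ∈ d.D.roots := by
  rw [toMatrix_element]
  split_ifs with h <;> simp [h]

theorem isRookMatrix (d : RookDatum n K) : IsRookMatrix (toMatrix d.element) where
  row i j k hj hk := by
    rw [toMatrix_element_ne_zero_iff] at hj hk
    exact congrArg Prod.snd (d.D.row_inj _ hj _ hk rfl)
  col i j k hi hj := by
    rw [toMatrix_element_ne_zero_iff] at hi hj
    exact congrArg Prod.fst (d.D.col_inj _ hi _ hj rfl)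

theorem element_mem_radical (d : RookDatum n K) : d.element ∈ radical n K := fun i =>
  not_not.mp fun h => d.D.ne _ ((d.toMatrix_element_ne_zero_iff i i).mp h) rfl

theorem element_injective : Function.Injective (element (n := n) (K := K)) := by
  intro d d' h
  have hroots : d.D.roots = d'.D.roots := by
    ext ⟨i, j⟩
    rw [← toMatrix_element_ne_zero_iff, h, toMatrix_element_ne_zero_iff]
  obtain ⟨⟨D, _, _, _⟩, φ⟩ := d
  obtain ⟨⟨D', _, _, _⟩, φ'⟩ := d'
  obtain rfl : D = D' := hroots
  congr 1
  ext ⟨⟨i, j⟩, hij⟩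
  have hentry := congrFun (congrFun (congrArg toMatrix h) i) j
  rwa [toMatrix_element, toMatrix_element, dif_pos hij, dif_pos hij] at hentry

theorem exists_element_eq {X : BorelContraction n K} (hX : X ∈ radical n K)
    (hrook : IsRookMatrix (toMatrix X)) : ∃ d : RookDatum n K, d.element = X := by
  classical
  let roots : Finset (Fin n × Fin n) := {p | toMatrix X p.1 p.2 ≠ 0}
  have hmem {p : Fin n × Fin n} : p ∈ roots ↔ toMatrix X p.1 p.2 ≠ 0 := by simp [roots]
  let D : RookPlacement n :=
    { roots := roots
      ne := by
        rintro ⟨i, j⟩ hij (rfl : i = j)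
        exact hmem.mp hij (hX i)
      row_inj := by
        rintro ⟨i, j⟩ hij ⟨k, l⟩ hkl (rfl : i = k)
        exact Prod.ext rfl (hrook.row (hmem.mp hij) (hmem.mp hkl))
      col_inj := by
        rintro ⟨i, j⟩ hij ⟨k, l⟩ hkl (rfl : j = l)
        exact Prod.ext (hrook.col (hmem.mp hij) (hmem.mp hkl)) rfl }
  refine ⟨⟨D, fun γ => Units.mk0 (toMatrix X γ.1.1 γ.1.2) (hmem.mp γ.2)⟩,
    toMatrix.injective (Matrix.ext fun i j => ?_)⟩
  rw [toMatrix_element]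
  split_ifs with hij
  · rfl
  · exact (not_not.mp (mt hmem.mpr hij)).symm

theorem mem_superclass_iff {d : RookDatum n K} {g : unipotentGroup n K} :
    g ∈ d.superclass ↔ InTwoSidedOrbit (unipotentGroup n K) d.element (nilPart g) := Iff.rfl

theorem superclass_nonempty (d : RookDatum n K) : d.superclass.Nonempty :=
  ⟨nilPartEquiv.symm ⟨d.element, d.element_mem_radical⟩, by
    rw [mem_superclass_iff, nilPart_nilPartEquiv_symm]
    exact .refl _⟩

theorem disjoint_superclass {d d' : RookDatum n K} (hd : d ≠ d') :
    Disjoint d.superclass d'.superclass :=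
  Set.disjoint_left.mpr fun _ hg hg' => hd <| element_injective <|
    eq_of_inTwoSidedOrbit d.isRookMatrix d'.isRookMatrix <|
      (mem_superclass_iff.mp hg).trans (mem_superclass_iff.mp hg').symm

theorem iUnion_superclass : ⋃ d : RookDatum n K, d.superclass = Set.univ := by
  refine Set.eq_univ_of_forall fun g => Set.mem_iUnion.mpr ?_
  obtain ⟨Y, hY, hrook⟩ := exists_inTwoSidedOrbit_isRookMatrix (nilPart g)
  obtain ⟨d, rfl⟩ := exists_element_eq (mem_radical_of_inTwoSidedOrbit hY (nilPart_mem g)) hrook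
  exact ⟨d, hY.symm⟩

theorem exists_superclass_eq_one : ∃ d : RookDatum n K, d.superclass = {1} := by
  obtain ⟨d, hd⟩ := exists_element_eq (zero_mem (radical n K)) isRookMatrix_zero
  refine ⟨d, Set.ext fun g => ?_⟩
  rw [mem_superclass_iff, hd, Set.mem_singleton_iff, ← nilPart_eq_zero_iff]
  constructor
  · rintro ⟨a, b, h⟩
    simpa using h
  · intro h
    rw [h]
    exact .refl _

end Superclass

section Functional

theorem toMatrix_element_transpose (d : RookDatum n K) (i j : Fin n) :
    toMatrix d.transpose.element i j = toMatrix d.element j i := by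
  have hmem : (i, j) ∈ d.transpose.D.roots ↔ (j, i) ∈ d.D.roots :=
    ⟨d.D.swap_mem, fun h => Finset.mem_map.mpr ⟨_, h, rfl⟩⟩
  rw [toMatrix_element, toMatrix_element]
  by_cases h : (j, i) ∈ d.D.roots
  · rw [dif_pos h, dif_pos (hmem.mpr h)]
    rfl
  · rw [dif_neg h, dif_neg (mt hmem.mp h)]

theorem functional_eq_entryForm (d : RookDatum n K) (Y : BorelContraction n K) :
    d.functional Y = entryForm (toMatrix d.element) Y := by
  rw [functional, form_eq_sum, entryForm_apply, Finset.sum_comm]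
  refine Finset.sum_congr rfl fun i _ => Finset.sum_congr rfl fun j _ => ?_
  rw [toMatrix_element_transpose]
  split_ifs with h
  · rfl
  · obtain rfl : j = i := not_not.mp h
    rw [d.element_mem_radical, zero_mul]

theorem exists_entryForm_ne {d d' : RookDatum n K} (hd : d ≠ d') (a b c e : unipotentGroup n K) :
    ∃ X ∈ radical n K,
      entryForm (toMatrix d.element)
          ((a : (BorelContraction n K)ˣ) * X * (b : (BorelContraction n K)ˣ)) ≠
        entryForm (toMatrix d'.element)
          ((c : (BorelContraction n K)ˣ) * X * (e : (BorelContraction n K)ˣ)) := by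
  contrapose! hd
  refine element_injective (toMatrix.injective (eq_of_entryForm_mul_eq d.isRookMatrix
    d'.isRookMatrix d.element_mem_radical d'.element_mem_radical (c * a⁻¹) (e⁻¹ * b)
    fun X hX => ?_))
  have hX' := hd (((a⁻¹ : unipotentGroup n K) : (BorelContraction n K)ˣ) * X *
    ((e⁻¹ : unipotentGroup n K) : (BorelContraction n K)ˣ))
    (radical_mul_mem _ _ (mul_radical_mem hX))
  simpa [mul_assoc] using hX'

theorem exists_functional_mul_ne_zero (d : RookDatum n K) {X : BorelContraction n K}
    (hX : X ∈ radical n K) (hXD : X ∉ d.D.radicalSub K) :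
    ∃ Y ∈ radical n K, d.functional (X * Y) ≠ 0 := by
  have hentry : ∃ γ ∈ d.D.roots, ∃ α ∈ rootArm γ, toMatrix X α.1 α.2 ≠ 0 := by
    by_contra! h
    exact hXD ⟨hX, h⟩
  obtain ⟨⟨i, j⟩, hγ, ⟨_, k⟩, hα, hik⟩ := hentry
  obtain ⟨hrow, -, hkj, hlen⟩ := mem_rootArm_iff.mp hα
  obtain rfl := hrow.symm
  have hij := (d.toMatrix_element_ne_zero_iff i j).mpr hγ
  refine ⟨matrixUnit k j, matrixUnit_mem_radical hkj, ?_⟩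
  rw [functional_eq_entryForm, entryForm_mul_matrixUnit, Fintype.sum_eq_single i, if_pos hlen]
  · exact mul_ne_zero hij hik
  · intro m hm
    rw [d.isRookMatrix.apply_eq_zero_of_col hij hm, zero_mul, ite_self]

end Functional

section Character

variable [Finite K] {ε : AddChar K ℂ}

theorem isComplexCharacter_character (ε : AddChar K ℂ) (d : RookDatum n K) :
    IsComplexCharacter (d.character ε) :=
  have := nontrivial_indV (Subgroup.subtype_injective _)
    ((Algebra.lmul ℂ ℂ : ℂ →* Module.End ℂ ℂ).comp (d.linearCharacter ε))
  _root_.isComplexCharacter_character _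

theorem sum_addChar_functional_mul_of_mem (ε : AddChar K ℂ) (d : RookDatum n K)
    (h : d.D.subgroup K) :
    ∑ u : unipotentGroup n K, ε (d.functional
        (nilPart (h : unipotentGroup n K) * (u : (BorelContraction n K)ˣ))) =
      Nat.card (unipotentGroup n K) * d.linearCharacter ε h := by
  have hconst (u : unipotentGroup n K) : ε (d.functional
      (nilPart (h : unipotentGroup n K) * (u : (BorelContraction n K)ˣ))) =
        d.linearCharacter ε h := by
    rw [val_eq_one_add_nilPart, mul_add, mul_one, functional_add,
      d.functional_mul h.2 (nilPart_mem u), add_zero]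
    rfl
  simp only [hconst, Finset.sum_const, nsmul_eq_mul, Finset.card_univ, Nat.card_eq_fintype_card]

theorem sum_addChar_functional_mul_of_notMem (hε : ε ≠ 1) (d : RookDatum n K)
    {g : unipotentGroup n K} (hg : g ∉ d.D.subgroup K) :
    ∑ u : unipotentGroup n K,
      ε (d.functional (nilPart g * (u : (BorelContraction n K)ˣ))) = 0 := by
  have hnil : ∑ u : unipotentGroup n K, ε (d.functional (nilPart g * nilPart u)) = 0 := by
    have hne := d.exists_functional_mul_ne_zero (nilPart_mem g) hg
    simp only [functional_eq_entryForm] at hne ⊢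
    exact sum_addChar_nilPart_eq_zero hε
      (f := entryForm (toMatrix d.element) ∘ₗ LinearMap.mulLeft K (nilPart g)) hne
  simp only [val_eq_one_add_nilPart, mul_add, mul_one, functional_add, AddChar.map_add_eq_mul,
    ← Finset.mul_sum, hnil, mul_zero]

open Classical in
theorem sum_addChar_functional_mul (hε : ε ≠ 1) (d : RookDatum n K) [Fintype (d.D.subgroup K)]
    (g : unipotentGroup n K) :
    ∑ u : unipotentGroup n K, ε (d.functional (nilPart g * (u : (BorelContraction n K)ˣ))) =
      Nat.card (unipotentGroup n K) *
        ∑ h with (d.D.subgroup K).subtype h = g, d.linearCharacter ε h := by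
  by_cases hg : g ∈ d.D.subgroup K
  · have hfiber : Finset.univ.filter (fun h => (d.D.subgroup K).subtype h = g) = {⟨g, hg⟩} :=
      Finset.ext fun h => by
        rw [Finset.mem_filter_univ, Finset.mem_singleton]
        exact ⟨fun e => Subtype.ext e, congrArg Subtype.val⟩
    rw [hfiber, Finset.sum_singleton, ← sum_addChar_functional_mul_of_mem]
  · rw [sum_addChar_functional_mul_of_notMem hε d hg, Finset.sum_eq_zero, mul_zero]
    exact fun h hh => absurd ((Finset.mem_filter_univ _).mp hh ▸ h.2) hg

theorem character_eq_sum (hε : ε ≠ 1) (d : RookDatum n K) (g : unipotentGroup n K) :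
    d.character ε g =
      ((Nat.card (d.D.subgroup K) : ℂ) * Nat.card (unipotentGroup n K))⁻¹ *
        ∑ p : unipotentGroup n K × unipotentGroup n K,
          ε (d.functional ((p.1 : (BorelContraction n K)ˣ) * nilPart g *
            (p.2 : (BorelContraction n K)ˣ))) := by
  classical
  have := Fintype.ofFinite (d.D.subgroup K)
  have hU : (Nat.card (unipotentGroup n K) : ℂ) ≠ 0 := Nat.cast_ne_zero.mpr Nat.card_pos.ne'
  rw [character, character_ind _ _ (Nat.cast_ne_zero.mpr Fintype.card_ne_zero),
    ← Nat.card_eq_fintype_card, mul_inv, mul_assoc, Fintype.sum_prod_type]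
  congr 1
  rw [eq_inv_mul_iff_mul_eq₀ hU, Finset.mul_sum]
  refine Finset.sum_congr rfl fun x _ => ?_
  have htrace (h : d.D.subgroup K) : Representation.character
      ((Algebra.lmul ℂ ℂ : ℂ →* Module.End ℂ ℂ).comp (d.linearCharacter ε)) h =
        d.linearCharacter ε h := Algebra.trace_self_apply _
  simp only [htrace]
  rw [← sum_addChar_functional_mul hε, ← Equiv.sum_comp (Equiv.mulLeft x)]
  simp only [nilPart_conj, Equiv.coe_mulLeft, Subgroup.coe_mul, Units.val_mul]
  simp [mul_assoc]

theorem character_eq_of_mem_superclass (hε : ε ≠ 1) (d : RookDatum n K) {d' : RookDatum n K}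
    {g h : unipotentGroup n K} (hg : g ∈ d'.superclass) (hh : h ∈ d'.superclass) :
    d.character ε g = d.character ε h := by
  have hgh := (mem_superclass_iff.mp hg).symm.trans (mem_superclass_iff.mp hh)
  rw [character_eq_sum hε, character_eq_sum hε,
    hgh.sum_eq fun X : BorelContraction n K => ε (d.functional X)]

theorem characterInner_addChar_functional (hε : ε ≠ 1) {d d' : RookDatum n K} (hd : d ≠ d')
    (a b c e : unipotentGroup n K) :
    characterInner
      (fun g : unipotentGroup n K => ε (d.functional ((a : (BorelContraction n K)ˣ) * nilPart g *
        (b : (BorelContraction n K)ˣ))))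
      (fun g : unipotentGroup n K => ε (d'.functional ((c : (BorelContraction n K)ˣ) * nilPart g *
        (e : (BorelContraction n K)ˣ)))) = 0 := by
  obtain ⟨X, hX, hne⟩ := exists_entryForm_ne hd a b c e
  let f (d : RookDatum n K) (a b : BorelContraction n K) : BorelContraction n K →ₗ[K] K :=
    entryForm (toMatrix d.element) ∘ₗ LinearMap.mulRight K b ∘ₗ LinearMap.mulLeft K a
  have hsum := sum_addChar_nilPart_eq_zero hε
    (f := f d (a : (BorelContraction n K)ˣ) (b : (BorelContraction n K)ˣ) -
      f d' (c : (BorelContraction n K)ˣ) (e : (BorelContraction n K)ˣ))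
    ⟨X, hX, sub_ne_zero.mpr hne⟩
  simp only [functional_eq_entryForm]
  rw [characterInner, mul_eq_zero, ← hsum]
  refine .inr (Finset.sum_congr rfl fun g _ => ?_)
  rw [← AddChar.map_neg_eq_conj, ← AddChar.map_add_eq_mul, ← sub_eq_add_neg]
  rfl

theorem characterInner_character (hε : ε ≠ 1) {d d' : RookDatum n K} (hd : d ≠ d') :
    characterInner (d.character ε) (d'.character ε) = 0 := by
  rw [funext (d.character_eq_sum hε), funext (d'.character_eq_sum hε),
    characterInner_mul_sum_mul_sum]
  simp only [characterInner_addChar_functional hε hd, Finset.sum_const_zero, mul_zero]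

end Character

end RookDatum

theorem theorem3p7_general (n : ℕ) (K : Type*) [Field K] [Finite K] (ε : AddChar K ℂ)
    (hε : ε ≠ 1) :
    IsSupercharacterTheory
      (fun d : RookDatum n K => d.character ε)
      (fun d : RookDatum n K => d.superclass) where
  isCharacter := RookDatum.isComplexCharacter_character ε
  nonempty := RookDatum.superclass_nonempty
  disjoint _ _ := RookDatum.disjoint_superclass
  cover := RookDatum.iUnion_superclass
  orthogonal _ _ := RookDatum.characterInner_character hε
  constant d _ _ hg _ hh := d.character_eq_of_mem_superclass hε hg hh
  one := RookDatum.exists_superclass_eq_one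

theorem theorem3p7 (n : ℕ) (K : Type*) [Field K] [Finite K] (hK : ringChar K ≠ 2)
    (ε : AddChar K ℂ) (hε : ε ≠ 1) :
    IsSupercharacterTheory
      (fun d : RookDatum n K => d.character ε)
      (fun d : RookDatum n K => d.superclass) :=
  theorem3p7_general n K ε hε
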